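/- **$\delta$-sufficing bound.** Consider an $N$-armed bandit in which picking arm $i$ gives an independent Gaussian reward with unknown mean $m_i$ and known variance $\sigma_i^2>0$. A policy (possibly randomized) picks an arm in each round on the basis of the previous decisions and rewards, and at some random time, after $T^*\in\{0,1,2,\dots\}\cup\{\infty\}$ exploration rounds, it settles on the arm it picks next. For a threshold $\mathcal M$, arm $i$ is *satisfying* if $m_i\ge\mathcal M$. Let $m_{i^*}=\max_j m_j$, let $\Delta_i=m_{i^*}-m_i$, and let $n_i^{T^*}$ be the number of exploration rounds in which arm $i$ is picked. The range of the $\delta$-sufficing problem is $m_{\sigma(2)}<\mathcal M\le m_{\sigma(1)}=m_{i^*}$, where $\sigma$ sorts the means in decreasing order; that is, exactly one arm is satisfying. A policy *solves the $\delta$-sufficing problem for $\mathcal M$* if, for every mean vector $m$ in this range, with probability at least $1-\delta$ it settles on an arm (that is, $T^*<\infty$) and this arm is satisfying. Then for every $\delta_0\in(0,\tfrac12)$ there is a constant $c>0$, depending on $\delta_0$ only, such that for all $N$, all variances $\sigma_i^2>0$ and all $\delta\in(0,\delta_0]$ the following hold. 1. If a policy (not relying on the threshold) solves the $\delta$-sufficing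 problem for every $\mathcal M\in\mathbb R$, then for all $m$ and $\mathcal M$ with $m_{\sigma(2)}<\mathcal M\le m_{i^*}$ and every suboptimal arm $i$, $$\mathbb E_m\big[n_i^{T^*}\big]\ \ge\ c\,\frac{\sigma_i^2}{\epsilon^2}\,\log\frac1\delta,\qquad \epsilon=\Delta_i .$$ 2. If a policy solves the $\delta$-sufficing problem for one given $\mathcal M$, then the same bound holds with $\epsilon=\Delta_i=\mathcal M-m_i$ for every $m$ with $m_{\sigma(2)}<\mathcal M=m_{i^*}$ and every suboptimal arm $i$. -/

import Mathlib

open MeasureTheory ProbabilityTheory Finset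
open scoped NNReal ENNReal

namespace SatisficingBandit

/-- What the agent decides in one round: the arm it picks, and a flag saying whether it has stopped
exploring and settled on that arm (`true`) or is still exploring (`false`). -/
abbrev Decision (N : ℕ) : Type := Bool × Fin N

/-- The record of one round: the decision, and the reward collected from the picked arm. -/
abbrev Round (N : ℕ) : Type := Decision N × ℝ

/-- A (possibly randomized) policy for an `N`-armed bandit. The decision in round `0` is drawn from
`init`; the decision in round `n + 1` is drawn from a law that depends only on the decisions and
rewards of the rounds `0, …, n`. -/
structure Policy (N : ℕ) where
  init : Measure (Decision N)
  isProbabilityMeasure_init : IsProbabilityMeasure init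
  next : (n : ℕ) → Kernel (Π _ : Iic n, Round N) (Decision N)
  isMarkovKernel_next : ∀ n, IsMarkovKernel (next n)

attribute [instance] Policy.isProbabilityMeasure_init Policy.isMarkovKernel_next

variable {N : ℕ}

/-- The law of the reward given the decision: picking arm `i` yields a Gaussian reward with mean
`m i` and variance `v i`. -/
noncomputable def rewardKernel (m : Fin N → ℝ) (v : Fin N → ℝ≥0) : Kernel (Decision N) ℝ where
  toFun d := gaussianReal (m d.2) (v d.2)
  measurable' := measurable_of_countable _

instance (m : Fin N → ℝ) (v : Fin N → ℝ≥0) : IsMarkovKernel (rewardKernel m v) :=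
  ⟨fun d => inferInstanceAs (IsProbabilityMeasure (gaussianReal (m d.2) (v d.2)))⟩

/-- The law of the infinite sequence of rounds when `π` is run on the Gaussian bandit with means `m`
and variances `v`: in each round the decision is drawn from the policy given the history, and then
the reward is drawn from the picked arm. -/
noncomputable def law (π : Policy N) (m : Fin N → ℝ) (v : Fin N → ℝ≥0) : Measure (ℕ → Round N) :=
  Kernel.trajMeasure (X := fun _ => Round N) (π.init ⊗ₘ rewardKernel m v)
    (fun n => π.next n ⊗ₖ Kernel.prodMkLeft (Π _ : Iic n, Round N) (rewardKernel m v))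

/-- The arm picked in round `t`. -/
def armAt (ω : ℕ → Round N) (t : ℕ) : Fin N := (ω t).1.2

/-- The agent declares in round `t` that it has settled on the arm it picks. -/
def SettledAt (ω : ℕ → Round N) (t : ℕ) : Prop := (ω t).1.1 = true

/-- `T*`: the number of exploration rounds, i.e. the index of the first round in which the agent
settles on an arm (`⊤` if it never does). -/
noncomputable def horizon (ω : ℕ → Round N) : ℕ∞ := ⨅ t : ℕ, ⨅ _ : SettledAt ω t, (t : ℕ∞)

/-- `n_i^{T*}`: the number of exploration rounds (those before `T*`) in which arm `i` is picked. -/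
noncomputable def sampleCount (i : Fin N) (ω : ℕ → Round N) : ℕ∞ :=
  Set.encard {t : ℕ | (t : ℕ∞) < horizon ω ∧ armAt ω t = i}

/-- Arm `i` is satisfying (in mean reward) for the threshold `M`. -/
def Satisfying (m : Fin N → ℝ) (M : ℝ) (i : Fin N) : Prop := M ≤ m i

/-- The threshold lies in the range of the `δ`-sufficing problem, `m_{σ(2)} < M ≤ m_{σ(1)}` for the
sorted means: exactly one arm is satisfying. -/
def IsSufficingThreshold (m : Fin N → ℝ) (M : ℝ) : Prop := ∃! i, Satisfying m M i

/-- The policy `π` solves the `δ`-sufficing problem for the threshold `M` and variances `v`: whatever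
the unknown means in the range of the problem, the policy settles on an arm, and this arm is
satisfying, with probability at least `1 - δ`. -/
def SolvesSufficing (π : Policy N) (v : Fin N → ℝ≥0) (M δ : ℝ) : Prop :=
  ∀ m : Fin N → ℝ, IsSufficingThreshold m M →
    ENNReal.ofReal (1 - δ) ≤
      law π m v {ω | ∃ t : ℕ, horizon ω = t ∧ Satisfying m M (armAt ω t)}

/-- `E[n_i^{T*}]`. -/
noncomputable def expectedSamples (π : Policy N) (m : Fin N → ℝ) (v : Fin N → ℝ≥0) (i : Fin N) :
    ℝ≥0∞ :=
  ∫⁻ ω, (sampleCount i ω : ℝ≥0∞) ∂(law π m v)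

/-- `Δ_i = m_{i*} - m_i`. -/
noncomputable def gap (m : Fin N → ℝ) (i : Fin N) : ℝ := (⨆ j, m j) - m i

end SatisficingBandit

namespace SatisficingBandit

variable {N : ℕ}

/-! The argument is a change of measure. Let `k` be the satisfying arm under `m` and `i` another
arm. Choose means `m'` that agree with `m`, exactly or almost, except on arm `i`, and for which `i`
is the only satisfying arm. A policy that is correct on both instances settles on `k` with
probability at least `1 - δ` under `m`, and at most `δ` under `m'`. Such a discrepancy forces a
Kullback–Leibler divergence of order `log (1 / δ)` between the two laws of the exploration data
(`integral_le_of_lintegral_exp`). Each exploration of arm `j` contributes `(m' j - m j) ^ 2 / (2 * v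
j)` to this divergence, so essentially only arm `i` can pay for it, and its expected count is
bounded below.

Two points need care. Only exploration rounds may count, so the likelihood ratio is stopped at
settling; it still has mean one and still transports the settling events
(`lintegral_exp_exploringLogRatio`, `lintegral_settlesBy_exp_exploringLogRatio`). And `T*` may have
infinite mean, so everything is truncated at `n` rounds. When `m'` has to differ from `m` on arm `k`
too, that difference is chosen after `n`, so small that `n` rounds of it are negligible
(`sampleConst_mul_le_expectedSamples`). -/

instance isProbabilityMeasure_law (π : Policy N) (m : Fin N → ℝ) (v : Fin N → ℝ≥0) :
    IsProbabilityMeasure (law π m v) := by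
  unfold law
  infer_instance

/-! ### Disintegration of the law along one round -/

/-- The law of the decision in round `n` given the past rounds. -/
noncomputable def decisionKernel (π : Policy N) : ℕ → Kernel (ℕ → Round N) (Decision N)
  | 0 => Kernel.const _ π.init
  | n + 1 => (π.next n).comap (Preorder.frestrictLe n) (by fun_prop)

instance isMarkovKernel_decisionKernel (π : Policy N) (n : ℕ) :
    IsMarkovKernel (decisionKernel π n) := by
  cases n <;> · unfold decisionKernel; infer_instance

theorem decisionKernel_congr (π : Policy N) {n : ℕ} {ω ω' : ℕ → Round N}
    (h : ∀ t < n, ω t = ω' t) : decisionKernel π n ω = decisionKernel π n ω' := by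
  cases n with
  | zero => simp [decisionKernel]
  | succ n =>
    simp only [decisionKernel, Kernel.comap_apply]
    congr 1
    ext1 t
    exact h t (Nat.lt_succ_of_le (mem_Iic.1 t.2))

/-- `trajMeasure` starts from a history indexed by `Iic 0`, which `piUnique` identifies with a
single round. -/
theorem law_map_zero (π : Policy N) (m : Fin N → ℝ) (v : Fin N → ℝ≥0) :
    (law π m v).map (fun ω => ω 0) = π.init ⊗ₘ rewardKernel m v := by
  have h0 : (fun ω : ℕ → Round N => ω 0) =
      (MeasurableEquiv.piUnique (fun _ : Iic 0 => Round N)) ∘ Preorder.frestrictLe 0 := rfl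
  rw [h0, ← Measure.map_map (by fun_prop) (by fun_prop), law, Kernel.trajMeasure,
    Measure.map_comp _ _ (by fun_prop), Kernel.traj_map_frestrictLe, Kernel.partialTraj_self,
    Measure.id_comp, Measure.map_map (by fun_prop) (by fun_prop)]
  convert Measure.map_id
  ext1 x
  exact MeasurableEquiv.apply_symm_apply _ _

/-- Turns a history and the next round into a full sequence. The padding beyond round `n + 1` is
arbitrary: only functions of the rounds up to `n + 1` are evaluated there. -/
theorem measurable_extend (n : ℕ) : Measurable
    (fun p : (Π _ : Iic n, Round N) × Round N =>
      (fun t => if h : t ≤ n then p.1 ⟨t, mem_Iic.2 h⟩ else p.2 : ℕ → Round N)) := by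
  refine measurable_pi_lambda _ fun t => ?_
  split_ifs <;> fun_prop

/-- A function of the rounds `0, …, n` is integrated by drawing the decision of round `n` from the
policy and its reward from the picked arm. -/
theorem lintegral_law_step (π : Policy N) (m : Fin N → ℝ) (v : Fin N → ℝ≥0) (n : ℕ)
    {f : (ℕ → Round N) → ℝ≥0∞} (hf : Measurable f) (hdep : DependsOn f (Set.Iic n)) :
    ∫⁻ ω, f ω ∂(law π m v) =
      ∫⁻ ω, ∫⁻ d, ∫⁻ r, f (Function.update ω n (d, r)) ∂(rewardKernel m v d)
        ∂(decisionKernel π n ω) ∂(law π m v) := by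
  cases n with
  | zero =>
    have hg : Measurable fun x : Round N => f (fun _ => x) := hf.comp (by fun_prop)
    have h1 : ∀ ω, f ω = f (fun _ => ω 0) := fun ω => hdep (by simp)
    have h2 : ∀ ω d r, f (Function.update ω 0 (d, r)) = f (fun _ => (d, r)) :=
      fun ω d r => hdep (by simp)
    calc ∫⁻ ω, f ω ∂(law π m v) = ∫⁻ ω, f (fun _ => ω 0) ∂(law π m v) :=
          lintegral_congr h1
      _ = ∫⁻ x, f (fun _ => x) ∂((law π m v).map (fun ω => ω 0)) :=
          (lintegral_map hg (by fun_prop)).symm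
      _ = ∫⁻ d, ∫⁻ r, f (fun _ => (d, r)) ∂(rewardKernel m v d) ∂π.init := by
          rw [law_map_zero, Measure.lintegral_compProd hg]
      _ = _ := by simp [h2, decisionKernel]
  | succ n =>
    set e := fun p : (Π _ : Iic n, Round N) × Round N =>
      (fun t => if h : t ≤ n then p.1 ⟨t, mem_Iic.2 h⟩ else p.2 : ℕ → Round N) with he
    have hme : Measurable e := measurable_extend n
    have hg : Measurable fun p => f (e p) := hf.comp hme
    have h1 : ∀ ω x, f (Function.update ω (n + 1) x) = f (e (Preorder.frestrictLe n ω, x)) := by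
      refine fun ω x => hdep fun t ht => ?_
      rcases Nat.lt_or_eq_of_le (Set.mem_Iic.1 ht) with h | h
      · have : t ≤ n := by omega
        simp [he, this, h.ne]
      · subst h; simp [he]
    have h2 : ∀ ω, f ω = f (e (Preorder.frestrictLe n ω, ω (n + 1))) := fun ω => by
      rw [← h1, Function.update_eq_self]
    have hp : Measurable fun ω : ℕ → Round N => (Preorder.frestrictLe n ω, ω (n + 1)) := by
      fun_prop
    have hk : (law π m v).map (Preorder.frestrictLe n) ⊗ₘ
        (π.next n ⊗ₖ Kernel.prodMkLeft (Π _ : Iic n, Round N) (rewardKernel m v)) =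
        (law π m v).map (fun ω => (Preorder.frestrictLe n ω, ω (n + 1))) :=
      Kernel.map_frestrictLe_trajMeasure_compProd_eq_map_trajMeasure (X := fun _ => Round N)
        (μ₀ := π.init ⊗ₘ rewardKernel m v)
        (κ := fun n => π.next n ⊗ₖ Kernel.prodMkLeft (Π _ : Iic n, Round N) (rewardKernel m v))
    calc ∫⁻ ω, f ω ∂(law π m v)
        = ∫⁻ ω, f (e (Preorder.frestrictLe n ω, ω (n + 1))) ∂(law π m v) := lintegral_congr h2
      _ = ∫⁻ p, f (e p) ∂((law π m v).map (fun ω => (Preorder.frestrictLe n ω, ω (n + 1)))) :=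
          (lintegral_map hg hp).symm
      _ = ∫⁻ h, ∫⁻ x, f (e (h, x)) ∂((π.next n ⊗ₖ
            Kernel.prodMkLeft (Π _ : Iic n, Round N) (rewardKernel m v)) h)
            ∂((law π m v).map (Preorder.frestrictLe n)) := by
          rw [← hk, Measure.lintegral_compProd hg]
      _ = ∫⁻ ω, ∫⁻ x, f (e (Preorder.frestrictLe n ω, x)) ∂((π.next n ⊗ₖ
            Kernel.prodMkLeft (Π _ : Iic n, Round N) (rewardKernel m v)) (Preorder.frestrictLe n ω))
            ∂(law π m v) := by
          rw [lintegral_map (Measurable.lintegral_kernel_prod_right' hg) (by fun_prop)]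
      _ = _ := by
          refine lintegral_congr fun ω => ?_
          rw [Kernel.lintegral_compProd _ _ _
            (f := fun x => f (e (Preorder.frestrictLe n ω, x))) (hg.comp (by fun_prop))]
          simp [h1, decisionKernel]

/-- `f` depends only on the rounds before round `n` and on the decision in round `n`. -/
def IsPredictable {β : Type*} (n : ℕ) (f : (ℕ → Round N) → β) : Prop :=
  ∀ ω ω', (∀ t < n, ω t = ω' t) → (ω n).1 = (ω' n).1 → f ω = f ω'

theorem IsPredictable.dependsOn {β : Type*} {n : ℕ} {f : (ℕ → Round N) → β}
    (hf : IsPredictable n f) : DependsOn f (Set.Iic n) :=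
  fun ω ω' h => hf ω ω' (fun t ht => h t ht.le) (by rw [h n (Set.mem_Iic.2 le_rfl)])

/-- Given the past and the decision, the reward of round `n` is drawn from the picked arm. -/
theorem lintegral_law_mul_round (π : Policy N) (m : Fin N → ℝ) (v : Fin N → ℝ≥0) (n : ℕ)
    {f : (ℕ → Round N) → ℝ≥0∞} (hf : Measurable f) (hpred : IsPredictable n f)
    {φ : Round N → ℝ≥0∞} (hφ : Measurable φ) :
    ∫⁻ ω, f ω * φ (ω n) ∂(law π m v) =
      ∫⁻ ω, f ω * ∫⁻ r, φ ((ω n).1, r) ∂(rewardKernel m v (ω n).1) ∂(law π m v) := by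
  have hΦ : Measurable fun d : Decision N => ∫⁻ r, φ (d, r) ∂(rewardKernel m v d) :=
    measurable_of_countable _
  have hd : ∀ ψ : Round N → ℝ≥0∞, DependsOn (fun ω : ℕ → Round N => f ω * ψ (ω n)) (Set.Iic n) :=
    fun ψ ω ω' h => by simp only [hpred.dependsOn h, h n (Set.mem_Iic.2 le_rfl)]
  rw [lintegral_law_step π m v n (f := fun ω => f ω * φ (ω n))
      (hf.mul (hφ.comp (measurable_pi_apply n))) (hd φ),
    lintegral_law_step π m v n
      (f := fun ω => f ω * ∫⁻ r, φ ((ω n).1, r) ∂(rewardKernel m v (ω n).1))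
      (hf.mul ((hΦ.comp measurable_fst).comp (measurable_pi_apply n)))
      (hd fun x => ∫⁻ r, φ (x.1, r) ∂(rewardKernel m v x.1))]
  refine lintegral_congr fun ω => lintegral_congr fun d => ?_
  -- Predictability: `f` does not see the reward of round `n`, so it is frozen at the dummy value
  -- `0` and leaves the inner integral.
  have h1 : ∀ r, f (Function.update ω n (d, r)) = f (Function.update ω n (d, 0)) :=
    fun r => hpred _ _ (fun t ht => by simp [Function.update_of_ne ht.ne]) (by simp)
  simp only [Function.update_self, h1]
  rw [lintegral_const_mul _ (f := fun r => φ (d, r)) (hφ.comp (by fun_prop))]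
  simp

/-! ### Likelihood ratios and change of measure -/

/-- The log-likelihood ratio of one reward, for the means `m'` against the means `m`. -/
noncomputable def logRatio (m m' : Fin N → ℝ) (v : Fin N → ℝ≥0) (x : Round N) : ℝ :=
  ((m' x.1.2 - m x.1.2) * (x.2 - m x.1.2) - (m' x.1.2 - m x.1.2) ^ 2 / 2) / v x.1.2

@[fun_prop]
theorem measurable_logRatio (m m' : Fin N → ℝ) (v : Fin N → ℝ≥0) :
    Measurable (logRatio m m' v) := by
  have h : ∀ g : Fin N → ℝ, Measurable fun x : Round N => g x.1.2 :=
    fun g => (measurable_of_countable g).comp (by fun_prop)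
  unfold logRatio
  have h1 := h m
  have h2 := h m'
  have h3 := h fun i => (v i : ℝ)
  fun_prop

/-- With equal variances the log of the density ratio is `((r - a) ^ 2 - (r - b) ^ 2) / (2 * s)`,
which is the exponent here expanded around `a`. -/
theorem lintegral_gaussianReal_eq_mul_exp {a b : ℝ} {s : ℝ≥0} (hs : s ≠ 0) {f : ℝ → ℝ≥0∞}
    (hf : Measurable f) :
    ∫⁻ r, f r ∂(gaussianReal b s) =
      ∫⁻ r, f r * ENNReal.ofReal (Real.exp (((b - a) * (r - a) - (b - a) ^ 2 / 2) / s))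
        ∂(gaussianReal a s) := by
  rw [gaussianReal_of_var_ne_zero _ hs, gaussianReal_of_var_ne_zero _ hs,
    lintegral_withDensity_eq_lintegral_mul _ (by fun_prop) hf,
    lintegral_withDensity_eq_lintegral_mul _ (by fun_prop) (by fun_prop)]
  refine lintegral_congr fun r => ?_
  simp only [Pi.mul_apply, gaussianPDF]
  rw [mul_comm (f r), ← mul_assoc, ← ENNReal.ofReal_mul (gaussianPDFReal_nonneg _ _ _)]
  congr 2
  simp only [gaussianPDFReal]
  rw [mul_assoc _ (Real.exp _), ← Real.exp_add]
  congr 2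
  have : (s : ℝ) ≠ 0 := by exact_mod_cast hs
  field_simp
  ring

theorem lintegral_rewardKernel_eq_mul_exp {v : Fin N → ℝ≥0} (hv : ∀ i, v i ≠ 0)
    (m m' : Fin N → ℝ) (d : Decision N) {f : ℝ → ℝ≥0∞} (hf : Measurable f) :
    ∫⁻ r, f r ∂(rewardKernel m' v d) =
      ∫⁻ r, f r * ENNReal.ofReal (Real.exp (logRatio m m' v (d, r))) ∂(rewardKernel m v d) :=
  lintegral_gaussianReal_eq_mul_exp (hv d.2) hf

/-- Change of measure between two instances, for functions of the first `n` rounds. -/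
theorem lintegral_law_change_measure (π : Policy N) {v : Fin N → ℝ≥0} (hv : ∀ i, v i ≠ 0)
    (m m' : Fin N → ℝ) (n : ℕ) {f : (ℕ → Round N) → ℝ≥0∞} (hf : Measurable f)
    (hdep : DependsOn f (Set.Iio n)) :
    ∫⁻ ω, f ω ∂(law π m' v) =
      ∫⁻ ω, f ω * ∏ t ∈ range n, ENNReal.ofReal (Real.exp (logRatio m m' v (ω t)))
        ∂(law π m v) := by
  induction n generalizing f with
  | zero =>
    obtain ⟨ω₀⟩ := (law π m v).nonempty_of_neZero
    have h : ∀ ω, f ω = f ω₀ := fun ω => hdep (by simp)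
    simp [h]
  | succ n ih =>
    set ρ : Round N → ℝ≥0∞ := fun x => ENNReal.ofReal (Real.exp (logRatio m m' v x)) with hρ
    have hmρ : Measurable ρ := by fun_prop
    have hupd : Measurable fun p : ((ℕ → Round N) × Decision N) × ℝ =>
        Function.update p.1.1 n (p.1.2, p.2) := by
      refine measurable_pi_lambda _ fun t => ?_
      by_cases h : t = n
      · subst h; simp only [Function.update_self]; fun_prop
      · simp only [Function.update_of_ne h]; fun_prop
    have hdep' : DependsOn f (Set.Iic n) := hdep.mono fun t ht => Nat.le_of_lt_succ ht
    have hmF : Measurable fun p : (ℕ → Round N) × Decision N =>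
        ∫⁻ r, f (Function.update p.1 n (p.2, r)) * ρ (p.2, r) ∂(rewardKernel m v p.2) := by
      have : Measurable fun q : ((ℕ → Round N) × Decision N) × ℝ =>
          f (Function.update q.1.1 n (q.1.2, q.2)) * ρ (q.1.2, q.2) :=
        (hf.comp hupd).mul (hmρ.comp (by fun_prop))
      exact Measurable.lintegral_kernel_prod_right'
        (κ := Kernel.prodMkLeft (ℕ → Round N) (rewardKernel m v)) this
    have hmG : Measurable fun ω : ℕ → Round N => ∫⁻ d,
        ∫⁻ r, f (Function.update ω n (d, r)) * ρ (d, r) ∂(rewardKernel m v d)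
          ∂(decisionKernel π n ω) :=
      Measurable.lintegral_kernel_prod_right' (κ := decisionKernel π n) hmF
    have hdG : DependsOn (fun ω : ℕ → Round N => ∫⁻ d,
        ∫⁻ r, f (Function.update ω n (d, r)) * ρ (d, r) ∂(rewardKernel m v d)
          ∂(decisionKernel π n ω)) (Set.Iio n) := by
      intro ω ω' h
      have h1 : ∀ x, f (Function.update ω n x) = f (Function.update ω' n x) := by
        refine fun x => hdep fun t ht => ?_
        by_cases htn : t = n
        · subst htn; simp
        · simp only [Function.update_of_ne htn]
          exact h t (by simp at ht ⊢; omega)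
      simp only [h1, decisionKernel_congr π (n := n) (fun t ht => h t ht)]
    have hmP : ∀ k, Measurable fun ω : ℕ → Round N => ∏ t ∈ range k, ρ (ω t) := fun k =>
      Finset.measurable_prod _ fun t _ => hmρ.comp (measurable_pi_apply t)
    have hdP : DependsOn (fun ω : ℕ → Round N => f ω * ∏ t ∈ range (n + 1), ρ (ω t))
        (Set.Iic n) := by
      intro ω ω' h
      simp only [hdep' h]
      congr 1
      exact prod_congr rfl fun t ht => by rw [h t (by simp at ht ⊢; omega)]
    rw [lintegral_law_step π m' v n hf hdep', lintegral_law_step π m v n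
      (f := fun ω => f ω * ∏ t ∈ range (n + 1), ρ (ω t)) (hf.mul (hmP _)) hdP]
    have hmf : ∀ (ω : ℕ → Round N) (d : Decision N),
        Measurable fun r : ℝ => f (Function.update ω n (d, r)) := fun ω d =>
      hf.comp (hupd.comp (by fun_prop : Measurable fun r : ℝ => ((ω, d), r)))
    simp only [lintegral_rewardKernel_eq_mul_exp hv m m' _ (hmf _ _)]
    -- Averaging out round `n` leaves a function of the rounds before `n`, to which the induction
    -- hypothesis applies.
    rw [ih hmG hdG]
    refine lintegral_congr fun ω => ?_
    rw [← lintegral_mul_const _ (measurable_of_countable _)]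
    refine lintegral_congr fun d => ?_
    rw [← lintegral_mul_const _ (f := fun r => f (Function.update ω n (d, r)) * ρ (d, r))
      ((hmf ω d).mul (hmρ.comp (by fun_prop)))]
    refine lintegral_congr fun r => ?_
    rw [prod_range_succ, Function.update_self, mul_assoc, mul_comm (ρ (d, r))]
    congr 2
    exact prod_congr rfl fun t ht => by rw [Function.update_of_ne (mem_range.1 ht).ne]

/-! ### Divergence bound from a single event -/

/-- A binary lower bound on the Kullback–Leibler divergence `-∫ ℓ ∂μ` of a tilted measure. -/
theorem integral_le_of_lintegral_exp {Ω : Type*} [MeasurableSpace Ω] {μ : Measure Ω}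
    [IsProbabilityMeasure μ] {ℓ : Ω → ℝ} (hℓ : Integrable ℓ μ) (hmℓ : Measurable ℓ) {A : Set Ω}
    (hA : MeasurableSet A) {δ : ℝ} (hδ : 0 < δ) (hδ' : δ < 1 / 2)
    (h1 : ∫⁻ ω, ENNReal.ofReal (Real.exp (ℓ ω)) ∂μ = 1)
    (h2 : ∫⁻ ω in A, ENNReal.ofReal (Real.exp (ℓ ω)) ∂μ ≤ ENNReal.ofReal δ) :
    (2 * μ.real A - 1) * Real.log ((1 - δ) / δ) ≤ - ∫ ω, ℓ ω ∂μ := by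
  set L := Real.log ((1 - δ) / δ) with hL
  have hexpL : Real.exp L = (1 - δ) / δ := Real.exp_log (div_pos (by linarith) hδ)
  have hexpL' : Real.exp (-L) = δ / (1 - δ) := by rw [Real.exp_neg, hexpL, inv_div]
  have hL0 : 0 ≤ L := Real.log_nonneg (by rw [le_div_iff₀ hδ]; linarith)
  have hme : Measurable fun ω => Real.exp (ℓ ω) := by fun_prop
  have hpos : ∀ ν : Measure Ω, 0 ≤ᵐ[ν] fun ω => Real.exp (ℓ ω) :=
    fun ν => Filter.Eventually.of_forall fun ω => (Real.exp_pos _).le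
  have hint : Integrable (fun ω => Real.exp (ℓ ω)) μ :=
    (lintegral_ofReal_ne_top_iff_integrable hme.aestronglyMeasurable (hpos μ)).1 (by simp [h1])
  have hI : ∫ ω, Real.exp (ℓ ω) ∂μ = 1 := by
    rw [integral_eq_lintegral_of_nonneg_ae (hpos μ) hme.aestronglyMeasurable, h1]; simp
  have hq : ∫ ω in A, Real.exp (ℓ ω) ∂μ ≤ δ := by
    rw [integral_eq_lintegral_of_nonneg_ae (hpos _) hme.aestronglyMeasurable]
    exact ENNReal.toReal_le_of_le_ofReal hδ.le h2
  -- The tangent inequality `x + 1 ≤ exp x`, used at `x = ℓ + L` on `A` and at `x = ℓ - L` off `A`;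
  -- the two cases are merged by indicators.
  have hpt : ∀ ω, ℓ ω ≤ Real.exp (-L) * Real.exp (ℓ ω)
      + (Real.exp L - Real.exp (-L)) * A.indicator (fun ω => Real.exp (ℓ ω)) ω
      + (L - 1) - 2 * L * A.indicator 1 ω := by
    intro ω
    by_cases h : ω ∈ A
    · have := Real.add_one_le_exp (L + ℓ ω)
      rw [Real.exp_add] at this
      simp only [Set.indicator_of_mem h, Pi.one_apply]
      linarith
    · have := Real.add_one_le_exp (-L + ℓ ω)
      rw [Real.exp_add] at this
      simp only [Set.indicator_of_notMem h]
      linarith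
  have hind : Integrable (A.indicator (1 : Ω → ℝ)) μ := (integrable_const (1 : ℝ)).indicator hA
  have i1 : Integrable (fun ω => Real.exp (-L) * Real.exp (ℓ ω)) μ := hint.const_mul _
  have i2 : Integrable (fun ω => (Real.exp L - Real.exp (-L)) *
      A.indicator (fun ω => Real.exp (ℓ ω)) ω) μ := (hint.indicator hA).const_mul _
  have i3 : Integrable (fun ω => Real.exp (-L) * Real.exp (ℓ ω) + (Real.exp L - Real.exp (-L)) *
      A.indicator (fun ω => Real.exp (ℓ ω)) ω) μ := i1.add i2
  have i4 : Integrable (fun ω => Real.exp (-L) * Real.exp (ℓ ω) + (Real.exp L - Real.exp (-L)) *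
      A.indicator (fun ω => Real.exp (ℓ ω)) ω + (L - 1)) μ := i3.add (integrable_const _)
  have i5 : Integrable (fun ω => 2 * L * A.indicator (1 : Ω → ℝ) ω) μ := hind.const_mul _
  have hmono := integral_mono hℓ (i4.sub i5) hpt
  simp only [Pi.sub_apply] at hmono
  rw [integral_sub i4 i5, integral_add i3 (integrable_const _), integral_add i1 i2,
    integral_const_mul, integral_const_mul, integral_const_mul, hI, integral_indicator hA,
    integral_indicator_one hA] at hmono
  simp only [integral_const, probReal_univ, one_smul] at hmono
  have hmul : (Real.exp L - Real.exp (-L)) * ∫ ω in A, Real.exp (ℓ ω) ∂μ ≤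
      (Real.exp L - Real.exp (-L)) * δ :=
    mul_le_mul_of_nonneg_left hq (sub_nonneg.2 (Real.exp_le_exp.2 (by linarith)))
  -- This identity dictates the choice of `L`: the exponential terms integrate to at most `1` and
  -- cancel the `-1` of the tangents.
  have hid : Real.exp (-L) + (Real.exp L - Real.exp (-L)) * δ = 1 := by
    rw [hexpL, hexpL']
    have : 1 - δ ≠ 0 := by linarith
    field_simp
    ring
  linarith

/-! ### Exploration and settling events -/

/-- The agent is still exploring in round `t`. -/
def exploring (N t : ℕ) : Set (ℕ → Round N) := {ω | ∀ s ≤ t, (ω s).1.1 = false}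

/-- The agent settles in round `k`, on arm `i`. -/
def settles (k : ℕ) (i : Fin N) : Set (ℕ → Round N) :=
  {ω | (∀ s < k, (ω s).1.1 = false) ∧ (ω k).1 = (true, i)}

@[measurability]
theorem measurableSet_exploring (t : ℕ) : MeasurableSet (exploring N t) := by
  have : exploring N t = ⋂ s, ⋂ (_ : s ≤ t), (fun ω => (ω s).1.1) ⁻¹' {false} := by
    ext; simp [exploring]
  rw [this]
  refine MeasurableSet.iInter fun s => MeasurableSet.iInter fun _ => ?_
  exact (by fun_prop : Measurable fun ω : ℕ → Round N => (ω s).1.1) (measurableSet_singleton _)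

@[measurability]
theorem measurableSet_settles (k : ℕ) (i : Fin N) : MeasurableSet (settles k i) := by
  have : settles k i = (⋂ s, ⋂ (_ : s < k), (fun ω => (ω s).1.1) ⁻¹' {false}) ∩
      (fun ω => (ω k).1) ⁻¹' {(true, i)} := by
    ext; simp [settles]
  rw [this]
  refine (MeasurableSet.iInter fun s => MeasurableSet.iInter fun _ => ?_).inter ?_
  · exact (by fun_prop : Measurable fun ω : ℕ → Round N => (ω s).1.1) (measurableSet_singleton _)
  · exact (by fun_prop : Measurable fun ω : ℕ → Round N => (ω k).1) (measurableSet_singleton _)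

theorem mem_exploring_congr {t : ℕ} {ω ω' : ℕ → Round N} (h : ∀ s ≤ t, (ω s).1 = (ω' s).1) :
    ω ∈ exploring N t ↔ ω' ∈ exploring N t :=
  forall₂_congr fun s hs => by rw [h s hs]

theorem isPredictable_indicator_exploring (t : ℕ) :
    IsPredictable t ((exploring N t).indicator (1 : (ℕ → Round N) → ℝ≥0∞)) := by
  classical
  intro ω ω' h h'
  simp only [Set.indicator_apply, Pi.one_apply]
  rw [mem_exploring_congr (ω' := ω')]
  intro s hs
  rcases hs.lt_or_eq with hs | rfl
  · rw [h s hs]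
  · exact h'

theorem isPredictable_indicator_settles (k : ℕ) (i : Fin N) :
    IsPredictable k ((settles k i).indicator (1 : (ℕ → Round N) → ℝ≥0∞)) := by
  classical
  intro ω ω' h h'
  have : ω ∈ settles k i ↔ ω' ∈ settles k i := by
    refine and_congr (forall₂_congr fun s hs => by rw [h s hs]) (by rw [h'])
  simp only [Set.indicator_apply, this, Pi.one_apply]

/-! ### The likelihood ratio stopped at settling -/

/-- The log-likelihood ratio of the rewards of the exploration rounds among the first `n` rounds. -/
noncomputable def exploringLogRatio (m m' : Fin N → ℝ) (v : Fin N → ℝ≥0) (n : ℕ)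
    (ω : ℕ → Round N) : ℝ :=
  ∑ t ∈ range n, (exploring N t).indicator (fun ω => logRatio m m' v (ω t)) ω

theorem measurable_exploringLogRatio (m m' : Fin N → ℝ) (v : Fin N → ℝ≥0) (n : ℕ) :
    Measurable (exploringLogRatio m m' v n) :=
  Finset.measurable_sum _ fun t _ => Measurable.indicator
    ((measurable_logRatio m m' v).comp (measurable_pi_apply t)) (measurableSet_exploring t)

theorem dependsOn_exploringLogRatio (m m' : Fin N → ℝ) (v : Fin N → ℝ≥0) (n : ℕ) :
    DependsOn (exploringLogRatio m m' v n) (Set.Iio n) := by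
  classical
  intro ω ω' h
  refine sum_congr rfl fun t ht => ?_
  have ht := mem_range.1 ht
  simp only [Set.indicator_apply, h t ht]
  rw [mem_exploring_congr fun s hs => by rw [h s (lt_of_le_of_lt hs ht)]]

theorem lintegral_exp_logRatio {v : Fin N → ℝ≥0} (hv : ∀ i, v i ≠ 0) (m m' : Fin N → ℝ)
    (d : Decision N) :
    ∫⁻ r, ENNReal.ofReal (Real.exp (logRatio m m' v (d, r))) ∂(rewardKernel m v d) = 1 := by
  have := lintegral_rewardKernel_eq_mul_exp hv m m' d (f := 1) measurable_one
  simpa using this.symm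

/-- A martingale argument: whether round `n` is exploratory is known before its reward, so the new
factor has conditional mean one if it is, and equals one otherwise. -/
theorem lintegral_exp_exploringLogRatio (π : Policy N) {v : Fin N → ℝ≥0} (hv : ∀ i, v i ≠ 0)
    (m m' : Fin N → ℝ) (n : ℕ) :
    ∫⁻ ω, ENNReal.ofReal (Real.exp (exploringLogRatio m m' v n ω)) ∂(law π m v) = 1 := by
  induction n with
  | zero => simp [exploringLogRatio]
  | succ n ih =>
    set E := fun ω => ENNReal.ofReal (Real.exp (exploringLogRatio m m' v n ω)) with hE
    set ρ : Round N → ℝ≥0∞ := fun x => ENNReal.ofReal (Real.exp (logRatio m m' v x)) with hρ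
    have hmE : Measurable E := by
      have := measurable_exploringLogRatio m m' v n
      fun_prop
    have hmρ : Measurable ρ := by fun_prop
    set I := (exploring N n).indicator (1 : (ℕ → Round N) → ℝ≥0∞) with hI
    set J := (exploring N n)ᶜ.indicator (1 : (ℕ → Round N) → ℝ≥0∞) with hJ
    have hmI : Measurable I := measurable_one.indicator (measurableSet_exploring n)
    have hIJ : ∀ ω, I ω + J ω = 1 := fun ω =>
      congrFun (Set.indicator_self_add_compl (exploring N n) (1 : (ℕ → Round N) → ℝ≥0∞)) ω
    have hpt : ∀ ω, ENNReal.ofReal (Real.exp (exploringLogRatio m m' v (n + 1) ω)) =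
        (E ω * I ω) * ρ (ω n) + E ω * J ω := by
      intro ω
      have hs : exploringLogRatio m m' v (n + 1) ω = exploringLogRatio m m' v n ω +
          (exploring N n).indicator (fun ω => logRatio m m' v (ω n)) ω := by
        simp [exploringLogRatio, sum_range_succ]
      rw [hs, Real.exp_add, ENNReal.ofReal_mul (Real.exp_pos _).le]
      by_cases h : ω ∈ exploring N n
      · simp [hI, hJ, hE, hρ, h]
      · simp [hI, hJ, hE, hρ, h]
    have hpred : IsPredictable n fun ω => E ω * I ω := by
      intro ω ω' h h'
      simp only [hE, dependsOn_exploringLogRatio m m' v n h,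
        isPredictable_indicator_exploring n ω ω' h h', hI]
    rw [lintegral_congr hpt, lintegral_add_left (f := fun ω => E ω * I ω * ρ (ω n))
        ((hmE.mul hmI).mul (hmρ.comp (measurable_pi_apply n))),
      lintegral_law_mul_round π m v n (f := fun ω => E ω * I ω) (hmE.mul hmI) hpred hmρ]
    simp only [hρ, lintegral_exp_logRatio hv, mul_one]
    rw [← lintegral_add_left (f := fun ω => E ω * I ω) (hmE.mul hmI)]
    simpa only [← mul_add, hIJ, mul_one] using ih

theorem exploring_of_settles {k t : ℕ} {i : Fin N} {ω : ℕ → Round N} (h : ω ∈ settles k i) :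
    ω ∈ exploring N t ↔ t < k := by
  constructor
  · intro ht
    by_contra! hk
    have h1 := ht k hk
    have h2 := h.2
    rw [Prod.ext_iff] at h2
    simp [h1] at h2
  · exact fun ht s hs => h.1 s (lt_of_le_of_lt hs ht)

/-- On this event the exploration rounds are exactly those before `k`, and the event does not depend
on any reward from round `k` on. The stopped ratio therefore serves as the full one. -/
theorem lintegral_settles_exp_exploringLogRatio (π : Policy N) {v : Fin N → ℝ≥0}
    (hv : ∀ i, v i ≠ 0) (m m' : Fin N → ℝ) {k n : ℕ} (hkn : k ≤ n) (i : Fin N) :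
    ∫⁻ ω in settles k i, ENNReal.ofReal (Real.exp (exploringLogRatio m m' v n ω)) ∂(law π m v) =
      law π m' v (settles k i) := by
  set ρ : Round N → ℝ≥0∞ := fun x => ENNReal.ofReal (Real.exp (logRatio m m' v x)) with hρ
  have hmρ : Measurable ρ := by fun_prop
  set I := (settles k i).indicator (1 : (ℕ → Round N) → ℝ≥0∞) with hI
  have hmI : Measurable I := measurable_one.indicator (measurableSet_settles k i)
  have hmP : Measurable fun ω : ℕ → Round N => ∏ t ∈ range k, ρ (ω t) :=
    Finset.measurable_prod _ fun t _ => hmρ.comp (measurable_pi_apply t)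
  have hpt : ∀ ω, (settles k i).indicator
      (fun ω => ENNReal.ofReal (Real.exp (exploringLogRatio m m' v n ω))) ω =
        I ω * ∏ t ∈ range k, ρ (ω t) := by
    intro ω
    by_cases h : ω ∈ settles k i
    · simp only [hI, Set.indicator_of_mem h, Pi.one_apply, one_mul, hρ, exploringLogRatio]
      rw [← ENNReal.ofReal_prod_of_nonneg fun _ _ => (Real.exp_pos _).le, ← Real.exp_sum]
      congr 2
      classical
      simp only [Set.indicator_apply, exploring_of_settles h]
      rw [← sum_filter]
      congr 1
      ext t
      simp
      omega
    · simp [hI, h]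
  have hpredI : IsPredictable k I := isPredictable_indicator_settles k i
  have hpred : IsPredictable k fun ω => I ω * ∏ t ∈ range k, ρ (ω t) := by
    intro ω ω' h h'
    simp only [hpredI ω ω' h h']
    congr 1
    exact prod_congr rfl fun t ht => by rw [h t (mem_range.1 ht)]
  -- The settling decision belongs to round `k`, so the change of measure uses `k + 1` factors; the
  -- last one averages to one by `hround`.
  have hdep : DependsOn I (Set.Iio (k + 1)) :=
    hpredI.dependsOn.mono fun t ht => Nat.lt_succ_of_le ht
  have hround := lintegral_law_mul_round π m v k (hmI.mul hmP) hpred hmρ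
  simp only [hρ, lintegral_exp_logRatio hv, mul_one] at hround
  rw [← lintegral_indicator (measurableSet_settles k i), lintegral_congr hpt,
    ← lintegral_indicator_one (measurableSet_settles k i),
    lintegral_law_change_measure π hv m m' (k + 1) hmI hdep]
  simp only [prod_range_succ, ← mul_assoc]
  exact hround.symm

/-- The agent settles on arm `i` within the first `n` exploration rounds. -/
def settlesBy (n : ℕ) (i : Fin N) : Set (ℕ → Round N) := ⋃ k ∈ range (n + 1), settles k i

theorem measurableSet_settlesBy (n : ℕ) (i : Fin N) : MeasurableSet (settlesBy n i) :=
  Finset.measurableSet_biUnion _ fun k _ => measurableSet_settles k i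

theorem lintegral_settlesBy_exp_exploringLogRatio (π : Policy N) {v : Fin N → ℝ≥0}
    (hv : ∀ i, v i ≠ 0) (m m' : Fin N → ℝ) (n : ℕ) (i : Fin N) :
    ∫⁻ ω in settlesBy n i, ENNReal.ofReal (Real.exp (exploringLogRatio m m' v n ω)) ∂(law π m v) =
      law π m' v (settlesBy n i) := by
  have hdisj : Set.PairwiseDisjoint (range (n + 1) : Set ℕ) fun k => settles k i := by
    have : ∀ k l : ℕ, k < l → Disjoint (settles k i) (settles l i) := by
      intro k l h
      rw [Set.disjoint_left]
      exact fun ω hk hl => lt_irrefl _ ((exploring_of_settles hk).1 ((exploring_of_settles hl).2 h))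
    intro k _ l _ hkl
    rcases lt_or_gt_of_ne hkl with h | h
    · exact this k l h
    · exact (this l k h).symm
  unfold settlesBy
  rw [measure_biUnion_finset hdisj fun k _ => measurableSet_settles k i,
    lintegral_biUnion_finset hdisj fun k _ => measurableSet_settles k i]
  exact sum_congr rfl fun k hk =>
    lintegral_settles_exp_exploringLogRatio π hv m m' (Nat.lt_succ_iff.1 (mem_range.1 hk)) i

/-! ### Expected log-likelihood ratio of the exploration rounds -/

/-- The Kullback–Leibler divergence of the rewards of arm `i` under two mean vectors. -/
noncomputable def armDivergence (m m' : Fin N → ℝ) (v : Fin N → ℝ≥0) (i : Fin N) : ℝ :=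
  (m' i - m i) ^ 2 / (2 * v i)

theorem integrable_rewardKernel (m : Fin N → ℝ) (v : Fin N → ℝ≥0) (d : Decision N) :
    Integrable (fun r : ℝ => r) (rewardKernel m v d) :=
  (memLp_id_gaussianReal (μ := m d.2) (v := v d.2) 1).integrable le_rfl

theorem integrable_logRatio (m m' : Fin N → ℝ) (v : Fin N → ℝ≥0) (d : Decision N) :
    Integrable (fun r => logRatio m m' v (d, r)) (rewardKernel m v d) :=
  ((((integrable_rewardKernel m v d).sub (integrable_const (m d.2))).const_mul
    (m' d.2 - m d.2)).sub (integrable_const ((m' d.2 - m d.2) ^ 2 / 2))).div_const (v d.2 : ℝ)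

theorem integral_logRatio (m m' : Fin N → ℝ) (v : Fin N → ℝ≥0) (d : Decision N) :
    ∫ r, logRatio m m' v (d, r) ∂(rewardKernel m v d) = - armDivergence m m' v d.2 := by
  have h := integrable_rewardKernel m v d
  have h0 : ∫ r, r ∂(rewardKernel m v d) = m d.2 :=
    integral_id_gaussianReal (μ := m d.2) (v := v d.2)
  have h1 : Integrable (fun r : ℝ => (m' d.2 - m d.2) * (r - m d.2)) (rewardKernel m v d) :=
    (h.sub (integrable_const (m d.2))).const_mul _
  simp only [logRatio]
  rw [integral_div, integral_sub h1 (integrable_const _), integral_const_mul,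
    integral_sub h (integrable_const _), h0]
  simp [armDivergence]
  ring

/-- Exploring at `t` is decided before the reward of round `t`, so restricting to it leaves the
reward kernel intact. This form gives access to Fubini for the signed, unbounded log ratio. -/
theorem map_restrict_exploring (π : Policy N) (m : Fin N → ℝ) (v : Fin N → ℝ≥0) (t : ℕ) :
    ((law π m v).restrict (exploring N t)).map (fun ω => ω t) =
      ((law π m v).restrict (exploring N t)).map (fun ω => (ω t).1) ⊗ₘ rewardKernel m v := by
  refine Measure.ext_of_lintegral _ fun φ hφ => ?_
  have hS := measurableSet_exploring (N := N) t
  have h := lintegral_law_mul_round π m v t (measurable_one.indicator hS)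
    (isPredictable_indicator_exploring t) hφ
  have hi : ∀ ψ : (ℕ → Round N) → ℝ≥0∞, ∀ ω,
      (exploring N t).indicator 1 ω * ψ ω = (exploring N t).indicator ψ ω := by
    intro ψ ω
    by_cases h : ω ∈ exploring N t <;> simp [h]
  rw [lintegral_congr (hi fun ω => φ (ω t)),
    lintegral_congr (hi fun ω => ∫⁻ r, φ ((ω t).1, r) ∂(rewardKernel m v (ω t).1)),
    lintegral_indicator hS, lintegral_indicator hS] at h
  rw [lintegral_map hφ (by fun_prop), h, Measure.lintegral_compProd hφ,
    lintegral_map (measurable_of_countable _) (by fun_prop)]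

theorem integrable_logRatio_restrict (π : Policy N) (m m' : Fin N → ℝ) (v : Fin N → ℝ≥0)
    (t : ℕ) :
    Integrable (logRatio m m' v)
      (((law π m v).restrict (exploring N t)).map (fun ω => ω t)) := by
  rw [map_restrict_exploring,
    Measure.integrable_compProd_iff (measurable_logRatio m m' v).aestronglyMeasurable]
  exact ⟨Filter.Eventually.of_forall fun d => integrable_logRatio m m' v d, Integrable.of_finite⟩

theorem integrable_indicator_logRatio (π : Policy N) (m m' : Fin N → ℝ) (v : Fin N → ℝ≥0)
    (t : ℕ) :
    Integrable ((exploring N t).indicator fun ω => logRatio m m' v (ω t)) (law π m v) := by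
  rw [integrable_indicator_iff (measurableSet_exploring t)]
  exact (integrable_logRatio_restrict π m m' v t).comp_measurable (by fun_prop)

theorem integral_indicator_logRatio (π : Policy N) (m m' : Fin N → ℝ) (v : Fin N → ℝ≥0)
    (t : ℕ) :
    ∫ ω, (exploring N t).indicator (fun ω => logRatio m m' v (ω t)) ω ∂(law π m v) =
      - ∫ ω in exploring N t, armDivergence m m' v (armAt ω t) ∂(law π m v) := by
  have hi := integrable_logRatio_restrict π m m' v t
  rw [integral_indicator (measurableSet_exploring t),
    ← integral_map (φ := fun ω : ℕ → Round N => ω t) (f := logRatio m m' v)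
      (measurable_pi_apply t).aemeasurable
      (measurable_logRatio m m' v).aestronglyMeasurable]
  rw [map_restrict_exploring] at hi ⊢
  rw [Measure.integral_compProd hi]
  simp only [integral_logRatio]
  rw [integral_map (by fun_prop : Measurable fun ω : ℕ → Round N => (ω t).1).aemeasurable
    (measurable_of_countable _).aestronglyMeasurable, integral_neg]
  rfl

/-- The transportation inequality of the bandit: telling two instances apart by the event that the
agent settles on arm `i` within `n` rounds requires exploration of the arms in which they differ. -/
theorem le_sum_setIntegral_armDivergence (π : Policy N) {v : Fin N → ℝ≥0} (hv : ∀ i, v i ≠ 0)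
    (m m' : Fin N → ℝ) (n : ℕ) (i : Fin N) {δ : ℝ} (hδ : 0 < δ) (hδ' : δ < 1 / 2)
    (h : law π m' v (settlesBy n i) ≤ ENNReal.ofReal δ) :
    (2 * (law π m v).real (settlesBy n i) - 1) * Real.log ((1 - δ) / δ) ≤
      ∑ t ∈ range n, ∫ ω in exploring N t, armDivergence m m' v (armAt ω t) ∂(law π m v) := by
  have hint : Integrable (exploringLogRatio m m' v n) (law π m v) :=
    integrable_finsetSum _ fun t _ => integrable_indicator_logRatio π m m' v t
  refine (integral_le_of_lintegral_exp hint (measurable_exploringLogRatio m m' v n)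
    (measurableSet_settlesBy n i) hδ hδ' (lintegral_exp_exploringLogRatio π hv m m' n)
    ((lintegral_settlesBy_exp_exploringLogRatio π hv m m' n i).trans_le h)).trans_eq ?_
  simp only [exploringLogRatio]
  rw [integral_finsetSum _ fun t _ => integrable_indicator_logRatio π m m' v t]
  simp only [integral_indicator_logRatio, sum_neg_distrib, neg_neg]

/-! ### From `horizon` and `sampleCount` to the settling events -/

theorem lt_horizon_of_mem_exploring {t : ℕ} {ω : ℕ → Round N} (h : ω ∈ exploring N t) :
    (t : ℕ∞) < horizon ω := by
  have h1 : ((t + 1 : ℕ) : ℕ∞) ≤ horizon ω := by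
    refine le_iInf₂ fun s hs => ?_
    have : t < s := by
      by_contra! hst
      have := h s hst
      simp [SettledAt, this] at hs
    exact_mod_cast this
  exact lt_of_lt_of_le (by exact_mod_cast Nat.lt_succ_self t) h1

theorem mem_settles_of_horizon_eq {t : ℕ} {ω : ℕ → Round N} (h : horizon ω = t) :
    ω ∈ settles t (armAt ω t) := by
  have hle : ∀ s, SettledAt ω s → t ≤ s := by
    intro s hs
    have : horizon ω ≤ s := iInf₂_le s hs
    rw [h] at this
    exact_mod_cast this
  have hlt : ∀ s < t, (ω s).1.1 = false := fun s hs =>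
    Bool.eq_false_iff.2 fun hc => absurd (hle s hc) (not_le.2 hs)
  refine ⟨hlt, Prod.ext ?_ rfl⟩
  by_contra hc
  have : ω ∈ exploring N t := by
    intro s hs
    rcases hs.lt_or_eq with hs | rfl
    · exact hlt s hs
    · exact Bool.eq_false_iff.2 hc
  exact absurd (lt_horizon_of_mem_exploring this) (by simp [h])

theorem settlesBy_mono (i : Fin N) : Monotone fun n => settlesBy n i := by
  intro a b hab
  exact Set.biUnion_subset_biUnion_left fun k hk => by simp at hk ⊢; omega

theorem disjoint_settlesBy {i j : Fin N} (hij : i ≠ j) (n l : ℕ) :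
    Disjoint (settlesBy n i) (settlesBy l j) := by
  rw [Set.disjoint_left]
  intro ω h h'
  simp only [settlesBy, Set.mem_iUnion] at h h'
  obtain ⟨k, -, hk⟩ := h
  obtain ⟨k', -, hk'⟩ := h'
  -- Both settling times are determined by the set of exploration rounds.
  have hkk : k = k' := eq_of_forall_lt_iff fun t => by
    rw [← exploring_of_settles hk, exploring_of_settles hk']
  subst hkk
  have := hk.2.symm.trans hk'.2
  simp at this
  exact hij this

theorem SolvesSufficing.le_law_iUnion_settlesBy {π : Policy N} {v : Fin N → ℝ≥0} {M δ : ℝ}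
    (h : SolvesSufficing π v M δ) {m : Fin N → ℝ} {i : Fin N} (hi : Satisfying m M i)
    (huniq : ∀ j, Satisfying m M j → j = i) :
    ENNReal.ofReal (1 - δ) ≤ law π m v (⋃ n, settlesBy n i) := by
  refine (h m ⟨i, hi, huniq⟩).trans (measure_mono ?_)
  rintro ω ⟨t, ht, hs⟩
  refine Set.mem_iUnion.2 ⟨t, Set.mem_biUnion (x := t) (by simp) ?_⟩
  rw [← huniq _ hs]
  exact mem_settles_of_horizon_eq ht

theorem exists_le_real_settlesBy {π : Policy N} {m : Fin N → ℝ} {v : Fin N → ℝ≥0} {i : Fin N}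
    {δ ε : ℝ} (hδ : δ ≤ 1) (hε : 0 < ε)
    (h : ENNReal.ofReal (1 - δ) ≤ law π m v (⋃ n, settlesBy n i)) :
    ∃ n, 1 - δ - ε ≤ (law π m v).real (settlesBy n i) := by
  have ht := tendsto_measure_iUnion_atTop (μ := law π m v) (settlesBy_mono i)
  have ht' := (ENNReal.tendsto_toReal (measure_ne_top _ _)).comp ht
  have hlt : 1 - δ - ε < (law π m v (⋃ n, settlesBy n i)).toReal := by
    have := ENNReal.toReal_mono (measure_ne_top _ _) h
    rw [ENNReal.toReal_ofReal (by linarith)] at this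
    linarith
  obtain ⟨n, hn⟩ := (ht'.eventually (lt_mem_nhds hlt)).exists
  exact ⟨n, hn.le⟩

theorem law_settlesBy_le {π : Policy N} {m : Fin N → ℝ} {v : Fin N → ℝ≥0} {i j : Fin N}
    (hij : i ≠ j) {δ : ℝ} (hδ : δ ≤ 1)
    (h : ENNReal.ofReal (1 - δ) ≤ law π m v (⋃ n, settlesBy n i)) (n : ℕ) :
    law π m v (settlesBy n j) ≤ ENNReal.ofReal δ := by
  have hsub : settlesBy n j ⊆ (⋃ n, settlesBy n i)ᶜ := by
    rw [Set.subset_compl_iff_disjoint_right, Set.disjoint_iUnion_right]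
    exact fun l => disjoint_settlesBy hij.symm n l
  refine (measure_mono hsub).trans ?_
  rw [prob_compl_eq_one_sub (MeasurableSet.iUnion fun n => measurableSet_settlesBy n i)]
  refine (tsub_le_tsub_left h 1).trans ?_
  rw [← ENNReal.ofReal_one, ← ENNReal.ofReal_sub _ (by linarith)]
  simp

/-- Truncation at `n` only discards samples. -/
theorem sum_law_exploring_inter_le (π : Policy N) (m : Fin N → ℝ) (v : Fin N → ℝ≥0) (i : Fin N)
    (n : ℕ) :
    ∑ t ∈ range n, law π m v (exploring N t ∩ {ω | armAt ω t = i}) ≤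
      expectedSamples π m v i := by
  classical
  have hS : ∀ t, MeasurableSet (exploring N t ∩ {ω : ℕ → Round N | armAt ω t = i}) := fun t =>
    (measurableSet_exploring t).inter
      ((by fun_prop : Measurable fun ω : ℕ → Round N => (ω t).1.2) (measurableSet_singleton i))
  simp only [← lintegral_indicator_one (hS _)]
  rw [← lintegral_finsetSum _ fun t _ => measurable_one.indicator (hS t)]
  refine lintegral_mono fun ω => ?_
  simp only [Set.indicator_apply, Pi.one_apply]
  rw [sum_boole]
  have h : ((({t ∈ range n | ω ∈ exploring N t ∩ {ω | armAt ω t = i}} : Finset ℕ).card : ℕ) : ℕ∞)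
      ≤ sampleCount i ω := by
    rw [← Set.encard_coe_eq_coe_finsetCard]
    refine Set.encard_le_encard fun t ht => ?_
    obtain ⟨-, h1, h2⟩ := mem_filter.1 (mem_coe.1 ht)
    exact ⟨lt_horizon_of_mem_exploring h1, h2⟩
  simpa using ENat.toENNReal_le.2 h

/-- The other arms are charged at most `κ` in each of the `n` rounds. This crude bound suffices
because `κ` will be chosen after `n`. -/
theorem sum_setIntegral_armDivergence_le (π : Policy N) (m m' : Fin N → ℝ) (v : Fin N → ℝ≥0)
    (i : Fin N) (n : ℕ) {κ : ℝ} (hκ : 0 ≤ κ) (h : ∀ j ≠ i, armDivergence m m' v j ≤ κ)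
    (hE : expectedSamples π m v i ≠ ⊤) :
    ∑ t ∈ range n, ∫ ω in exploring N t, armDivergence m m' v (armAt ω t) ∂(law π m v) ≤
      armDivergence m m' v i * (expectedSamples π m v i).toReal + n * κ := by
  classical
  set P := law π m v
  have hK : 0 ≤ armDivergence m m' v i := by unfold armDivergence; positivity
  have hS : ∀ t, MeasurableSet {ω : ℕ → Round N | armAt ω t = i} := fun t =>
    (by fun_prop : Measurable fun ω : ℕ → Round N => (ω t).1.2) (measurableSet_singleton i)
  have hterm : ∀ t, ∫ ω in exploring N t, armDivergence m m' v (armAt ω t) ∂P ≤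
      armDivergence m m' v i * P.real (exploring N t ∩ {ω | armAt ω t = i}) + κ := by
    intro t
    have hi1 : Integrable ({ω : ℕ → Round N | armAt ω t = i}.indicator (1 : (ℕ → Round N) → ℝ))
        (P.restrict (exploring N t)) := (integrable_const (1 : ℝ)).indicator (hS t)
    have hmono : ∫ ω in exploring N t, armDivergence m m' v (armAt ω t) ∂P ≤
        ∫ ω in exploring N t, (armDivergence m m' v i *
          {ω : ℕ → Round N | armAt ω t = i}.indicator (1 : (ℕ → Round N) → ℝ) ω + κ) ∂P := by
      refine integral_mono_of_nonneg (Filter.Eventually.of_forall fun ω => ?_)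
        ((hi1.const_mul _).add (integrable_const _)) (Filter.Eventually.of_forall fun ω => ?_)
      · simp only [armDivergence, Pi.zero_apply]; positivity
      · by_cases hω : armAt ω t = i
        · simp [hω, hκ]
        · simpa [hω] using h _ hω
    rw [integral_add (hi1.const_mul _) (integrable_const _), integral_const_mul,
      integral_indicator_one (hS t), measureReal_restrict_apply (hS t), Set.inter_comm] at hmono
    refine hmono.trans (add_le_add_right ?_ _)
    rw [integral_const, smul_eq_mul, measureReal_restrict_apply_univ]
    exact mul_le_of_le_one_left hκ measureReal_le_one
  have hsum : ∑ t ∈ range n, P.real (exploring N t ∩ {ω | armAt ω t = i}) ≤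
      (expectedSamples π m v i).toReal := by
    have := ENNReal.toReal_mono hE (sum_law_exploring_inter_le π m v i n)
    rwa [ENNReal.toReal_sum fun t _ => measure_ne_top _ _] at this
  calc _ ≤ ∑ t ∈ range n,
        (armDivergence m m' v i * P.real (exploring N t ∩ {ω | armAt ω t = i}) + κ) :=
        sum_le_sum fun t _ => hterm t
    _ = armDivergence m m' v i * ∑ t ∈ range n, P.real (exploring N t ∩ {ω | armAt ω t = i})
        + n * κ := by simp [sum_add_distrib, mul_sum]
    _ ≤ _ := by gcongr

/-! ### The constant and the lower bound for one arm -/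

/-- The constant of the lower bound. -/
noncomputable def sampleConst (δ₀ : ℝ) : ℝ :=
  (1 - 2 * δ₀) / 8 * (Real.log ((1 - δ₀) / δ₀) / Real.log (1 / δ₀))

theorem sampleConst_pos {δ₀ : ℝ} (h : 0 < δ₀) (h' : δ₀ < 1 / 2) : 0 < sampleConst δ₀ := by
  have h1 : 0 < Real.log ((1 - δ₀) / δ₀) := Real.log_pos (by rw [lt_div_iff₀ h]; linarith)
  have h2 : 0 < Real.log (1 / δ₀) := Real.log_pos (by rw [lt_div_iff₀ h]; linarith)
  have h3 : 0 < 1 - 2 * δ₀ := by linarith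
  unfold sampleConst
  positivity

/-- The ratio of `log ((1 - δ) / δ)` to `log (1 / δ)` is `1 - log (1 - δ) / log δ`, which decreases
in `δ`, so its worst value is at `δ₀`. -/
theorem sampleConst_mul_log_le {δ₀ δ : ℝ} (h' : δ₀ < 1 / 2) (hδ : 0 < δ)
    (hle : δ ≤ δ₀) :
    sampleConst δ₀ * Real.log (1 / δ) ≤ (1 - 2 * δ₀) / 8 * Real.log ((1 - δ) / δ) := by
  have h : 0 < δ₀ := hδ.trans_le hle
  have h2 : 0 < Real.log (1 / δ₀) := Real.log_pos (by rw [lt_div_iff₀ h]; linarith)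
  have e1 : ∀ x : ℝ, 0 < x → x < 1 → Real.log ((1 - x) / x) = Real.log (1 - x) - Real.log x :=
    fun x hx hx' => Real.log_div (by linarith) hx.ne'
  have e2 : ∀ x : ℝ, Real.log (1 / x) = - Real.log x := fun x => by simp
  have m1 : Real.log (1 - δ₀) ≤ Real.log (1 - δ) := Real.log_le_log (by linarith) (by linarith)
  have m2 : Real.log δ ≤ Real.log δ₀ := Real.log_le_log hδ hle
  have n1 : Real.log (1 - δ₀) ≤ 0 := Real.log_nonpos (by linarith) (by linarith)
  unfold sampleConst
  rw [mul_assoc]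
  refine mul_le_mul_of_nonneg_left ?_ (by linarith)
  rw [div_mul_eq_mul_div, div_le_iff₀ h2, e1 δ₀ h (by linarith), e1 δ hδ (by linarith), e2, e2]
  rw [e2] at h2
  nlinarith [mul_nonneg (sub_nonneg.2 m1) h2.le, mul_nonneg (sub_nonneg.2 m2) (neg_nonneg.2 n1)]

/-- If instances arbitrarily close to `m` on the arms other than `i` make the agent settle on `i`,
while under `m` it settles on another arm, then arm `i` has to be explored under `m`. -/
theorem sampleConst_mul_le_expectedSamples {π : Policy N} {v : Fin N → ℝ≥0} (hv : ∀ i, v i ≠ 0)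
    {δ₀ δ : ℝ} (hδ₀ : δ₀ < 1 / 2) (hδ : 0 < δ) (hle : δ ≤ δ₀) {m : Fin N → ℝ} {i k : Fin N}
    (hik : i ≠ k) (hm : ENNReal.ofReal (1 - δ) ≤ law π m v (⋃ n, settlesBy n k))
    {g : ℝ} (hg : 0 < g)
    (hm' : ∀ κ > 0, ∃ m' : Fin N → ℝ, |m' i - m i| ≤ 2 * g ∧
      (∀ j ≠ i, armDivergence m m' v j ≤ κ) ∧
      ENNReal.ofReal (1 - δ) ≤ law π m' v (⋃ n, settlesBy n i)) :
    ENNReal.ofReal (sampleConst δ₀ * (v i / g ^ 2) * Real.log (1 / δ)) ≤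
      expectedSamples π m v i := by
  by_cases hE : expectedSamples π m v i = ⊤
  · simp [hE]
  set E := (expectedSamples π m v i).toReal with hEdef
  have hE0 : 0 ≤ E := ENNReal.toReal_nonneg
  rw [← ENNReal.ofReal_toReal hE]
  refine ENNReal.ofReal_le_ofReal ?_
  set L := Real.log ((1 - δ) / δ) with hL
  have hL0 : 0 < L := Real.log_pos (by rw [lt_div_iff₀ hδ]; linarith)
  -- With this slack, `2 * P - 1` is still at least `(1 - 2 * δ₀) / 2`, where `P` is the probability
  -- of settling on `k` by `n`.
  obtain ⟨n, hn⟩ := exists_le_real_settlesBy (ε := (1 - 2 * δ₀) / 4) (by linarith) (by linarith) hm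
  -- Since `n` depends on `m` alone, `m'` may depend on `n`: this `κ` makes the other arms use up at
  -- most half of the divergence `(1 - 2 * δ₀) / 2 * L`.
  have hκ : 0 < (1 - 2 * δ₀) / 4 * L / (n + 1) :=
    div_pos (mul_pos (by linarith) hL0) (by positivity)
  obtain ⟨m', hi, hj, hQ⟩ := hm' _ hκ
  have h1 := le_sum_setIntegral_armDivergence π hv m m' n k hδ (by linarith)
    (law_settlesBy_le hik (by linarith) hQ n)
  have h2 := sum_setIntegral_armDivergence_le π m m' v i n hκ.le hj hE
  have hvi : 0 < (v i : ℝ) := by exact_mod_cast pos_iff_ne_zero.2 (hv i)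
  have h3 : armDivergence m m' v i ≤ 2 * (g ^ 2 / v i) := by
    unfold armDivergence
    have : (m' i - m i) ^ 2 ≤ (2 * g) ^ 2 := sq_le_sq' (by linarith [abs_le.1 hi]) (abs_le.1 hi).2
    rw [div_le_iff₀ (by positivity)]
    field_simp
    linarith
  have h4 : (n : ℝ) * ((1 - 2 * δ₀) / 4 * L / (n + 1)) ≤ (1 - 2 * δ₀) / 4 * L := by
    have hpos : 0 < (1 - 2 * δ₀) / 4 * L := mul_pos (by linarith) hL0
    rw [mul_div_assoc', div_le_iff₀ (by positivity)]
    nlinarith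
  have h5 : (1 - 2 * δ₀) / 2 * L ≤
      (2 * (law π m v).real (settlesBy n k) - 1) * L :=
    mul_le_mul_of_nonneg_right (by linarith) hL0.le
  have h6 := mul_le_mul_of_nonneg_right h3 hE0
  have h7 := sampleConst_mul_log_le hδ₀ hδ hle
  have h8 : sampleConst δ₀ * Real.log (1 / δ) ≤ g ^ 2 / v i * E := by linarith
  calc sampleConst δ₀ * (v i / g ^ 2) * Real.log (1 / δ)
      = v i / g ^ 2 * (sampleConst δ₀ * Real.log (1 / δ)) := by ring
    _ ≤ v i / g ^ 2 * (g ^ 2 / v i * E) := mul_le_mul_of_nonneg_left h8 (by positivity)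
    _ = E := by field_simp

theorem iSup_eq_of_unique_satisfying {m : Fin N → ℝ} {M : ℝ} {k : Fin N} (hk : Satisfying m M k)
    (huniq : ∀ j, Satisfying m M j → j = k) : ⨆ j, m j = m k := by
  have : Nonempty (Fin N) := ⟨k⟩
  refine le_antisymm (ciSup_le fun j => ?_) (le_ciSup (Set.finite_range m).bddAbove k)
  by_cases h : Satisfying m M j
  · rw [huniq j h]
  · exact (not_le.1 h).le.trans hk

end SatisficingBandit

theorem mainTheorem6 (δ₀ : ℝ) (hδ₀ : 0 < δ₀) (hδ₀' : δ₀ < 1 / 2) :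
    ∃ c : ℝ, 0 < c ∧
      ∀ (N : ℕ) (v : Fin N → ℝ≥0) (δ : ℝ) (π : SatisficingBandit.Policy N),
        (∀ i, v i ≠ 0) → 0 < δ → δ ≤ δ₀ →
        -- a policy that does not rely on the threshold
        ((∀ M : ℝ, SatisficingBandit.SolvesSufficing π v M δ) →
          ∀ (m : Fin N → ℝ) (M : ℝ), SatisficingBandit.IsSufficingThreshold m M →
            ∀ i, ¬ SatisficingBandit.Satisfying m M i →
              ENNReal.ofReal (c * (v i / SatisficingBandit.gap m i ^ 2) * Real.log (1 / δ)) ≤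
                SatisficingBandit.expectedSamples π m v i) ∧
        -- a policy designed for one threshold, on the instances where it is the largest mean
        (∀ M : ℝ, SatisficingBandit.SolvesSufficing π v M δ →
          ∀ m : Fin N → ℝ, SatisficingBandit.IsSufficingThreshold m M → M = ⨆ j, m j →
            ∀ i, ¬ SatisficingBandit.Satisfying m M i →
              ENNReal.ofReal (c * (v i / (M - m i) ^ 2) * Real.log (1 / δ)) ≤
                SatisficingBandit.expectedSamples π m v i) := by
  refine ⟨SatisficingBandit.sampleConst δ₀, SatisficingBandit.sampleConst_pos hδ₀ hδ₀', ?_⟩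
  intro N v δ π hv hδ hle
  constructor
  · intro hsol m M hM i hi
    obtain ⟨k, hk, huniq⟩ := hM
    have hik : i ≠ k := fun h => hi (h ▸ hk)
    have hsup := SatisficingBandit.iSup_eq_of_unique_satisfying hk huniq
    have hlt : m i < m k := (not_le.1 hi).trans_le hk
    have hgap : SatisficingBandit.gap m i = m k - m i := by rw [SatisficingBandit.gap, hsup]
    have hmax : ∀ j, m j ≤ m k := fun j => hsup ▸ le_ciSup (Set.finite_range m).bddAbove j
    rw [hgap]
    refine SatisficingBandit.sampleConst_mul_le_expectedSamples hv hδ₀' hδ hle hik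
      ((hsol M).le_law_iUnion_settlesBy hk huniq) (sub_pos.2 hlt) fun κ hκ => ?_
    -- Overshooting `m k` by the gap makes `i` the strict maximum. The new mean of `i` is itself
    -- taken as threshold, which is allowed since the policy handles every threshold; no other arm
    -- moves.
    refine ⟨Function.update m i (m i + 2 * (m k - m i)), ?_, fun j hj => ?_, ?_⟩
    · rw [Function.update_self, add_sub_cancel_left, abs_of_pos (by linarith)]
    · simp [SatisficingBandit.armDivergence, hj, hκ.le]
    · refine (hsol (m i + 2 * (m k - m i))).le_law_iUnion_settlesBy ?_ fun j hj => ?_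
      · simp [SatisficingBandit.Satisfying]
      · by_contra h
        simp only [SatisficingBandit.Satisfying, Function.update_of_ne h] at hj
        linarith [hmax j]
  · intro M hsol m hM hMsup i hi
    obtain ⟨k, hk, huniq⟩ := hM
    have hik : i ≠ k := fun h => hi (h ▸ hk)
    have hMk : M = m k := hMsup.trans (SatisficingBandit.iSup_eq_of_unique_satisfying hk huniq)
    have hlt : m i < M := not_le.1 hi
    refine SatisficingBandit.sampleConst_mul_le_expectedSamples hv hδ₀' hδ hle hik
      (hsol.le_law_iUnion_settlesBy hk huniq) (sub_pos.2 hlt) fun κ hκ => ?_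
    have hvk : 0 < (v k : ℝ) := by exact_mod_cast pos_iff_ne_zero.2 (hv k)
    -- Chosen so that lowering arm `k` by `η` costs a divergence of exactly `κ`.
    set η := √(2 * v k * κ) with hη
    have hη0 : 0 < η := Real.sqrt_pos.2 (by positivity)
    -- The threshold is fixed, so raising `i` to `M` would leave two satisfying arms. Because `m k =
    -- M`, an arbitrarily small decrease of arm `k` restores uniqueness.
    refine ⟨Function.update (Function.update m k (M - η)) i M, ?_, fun j hj => ?_, ?_⟩
    · rw [Function.update_self, abs_of_pos (by linarith)]
      linarith
    · rw [SatisficingBandit.armDivergence, Function.update_of_ne hj]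
      by_cases hjk : j = k
      · subst hjk
        rw [Function.update_self, hMk, sub_sub_cancel_left, neg_sq, hη,
          Real.sq_sqrt (by positivity), mul_div_cancel_left₀ _ (by positivity)]
      · rw [Function.update_of_ne hjk]
        simp [hκ.le]
    · refine hsol.le_law_iUnion_settlesBy ?_ fun j hj => ?_
      · simp [SatisficingBandit.Satisfying]
      · by_contra h
        simp only [SatisficingBandit.Satisfying, Function.update_of_ne h] at hj
        by_cases hjk : j = k
        · subst hjk
          rw [Function.update_self] at hj
          linarith
        · rw [Function.update_of_ne hjk] at hj
          exact hjk (huniq j hj)
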